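/- Let $(S,\rho)$ be a compact metric space, and let $s_\alpha\notin S$ be an additional point, with $\rho$ extended to a metric on $S\cup\{s_\alpha\}$ such that $\inf_{s\in S}\rho(s,s_\alpha)=\alpha$. Let $\mathfrak N$ be the space of finite counting measures $\mu=\sum_{i=1}^{m}\delta_{x_i}$ ($m\ge 0$, $x_i\in S$) on $S$, with cardinality $|\mu|=m$, equipped with the Borel $\sigma$-algebra of the vague topology. For $\mu_1=\sum_{i=1}^{k}\delta_{x_i}$ and $\mu_2=\sum_{i=1}^{m}\delta_{y_i}$ in $\mathfrak N$ with $k\le m$ put $$D_1(\mu_1,\mu_2)=D_1(\mu_2,\mu_1)=\min_{\pi}\Big[\sum_{i=1}^{k}\rho(x_i,y_{\pi(i)})+\sum_{i=k+1}^{m}\rho(s_\alpha,y_{\pi(i)})\Big],$$ the minimum being over all permutations $\pi$ of $\{1,\dots,m\}$. For $p\in[1,\infty)$ and probability measures $Q_1,Q_2$ on $\mathfrak N$ let $$W_p(Q_1,Q_2)=\Big(\inf_{\gamma}\int_{\mathfrak N\times\mathfrak N}D_1^p(\mu,\nu)\,d\gamma(\mu,\nu)\Big)^{1/p},$$ the infimum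 being over all measures $\gamma$ on $\mathfrak N\times\mathfrak N$ with marginals $Q_1$ and $Q_2$. For $\varepsilon>0$ let $\mathcal M_\varepsilon(S)$ be the least number of closed balls of radius $\varepsilon/2$ that cover $S$, and let $\dim_M(S)=\limsup_{\varepsilon\to0+}\frac{\log\mathcal M_\varepsilon(S)}{-\log\varepsilon}$. Let $\eta$ be a point process on $S$, i.e. a random element of $\mathfrak N$, with law $\mathcal L(\eta)$, let $\eta_1,\dots,\eta_n$ be i.i.d. copies of $\eta$, and let $\widehat{\mathcal L}_n(\eta)=\frac1n\sum_{i=1}^n\delta_{\eta_i}$ be their empirical measure. Assume (A1) $0<\dim_M(S)<\infty$; (A2) there are constants $K_1>0$ and $\lambda>0$ such that $P(|\eta|=m)\le K_1e^{-\lambda m}$ for every $m\in\{0,1,2,\dots\}$. Then for every $p\in[1,\infty)$ and every $\kappa>0$ there is a constant $C>0$ depending only on $\mathrm{diam}(S)$, $\dim_M(S)$, $K_1$, $\alpha$, $\kappa$, $p$ and $\lambda$ such that, for all sufficiently large $n$, $$E\big[W_p(\widehat{\mathcal L}_n(\eta),\mathcal L(\eta))\big]\le C\,e^{(1+\frac1{2p})\log\log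 n}\,e^{-2\sqrt{\frac{\lambda}{p(\dim_M(S)+\kappa)}}\sqrt{\log n}},$$ and consequently, for all sufficiently large $n$, $$E\big[W_p(\widehat{\mathcal L}_n(\eta),\mathcal L(\eta))\big]\le C\,e^{-2\sqrt{\frac{\lambda}{p(\dim_M(S)+2\kappa)}}\sqrt{\log n}}.$$ -/

import Mathlib

open MeasureTheory ProbabilityTheory Filter Topology
open scoped ENNReal NNReal CompactlySupported

universe u v w

noncomputable section

/-! ### Covering numbers and the Minkowski dimension -/

/-- The `ε`-covering number of `Y ⊆ X`: the least number of closed balls of diameter `ε`, that is,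
of radius `ε / 2`, with centres in `X`, that cover `Y`. -/
def ballCoveringNumber {X : Type*} [MetricSpace X] (ε : ℝ) (Y : Set X) : ℕ∞ :=
  Metric.externalCoveringNumber (ε / 2).toNNReal Y

/-- The (upper) Minkowski dimension `limsup_{ε → 0+} log M_ε(Y) / (- log ε)`, as an extended
real number. -/
def minkowskiDim {X : Type*} [MetricSpace X] (Y : Set X) : EReal :=
  limsup (fun ε : ℝ => ENNReal.log (ballCoveringNumber ε Y : ℝ≥0∞) / ((-Real.log ε : ℝ) : EReal))
    (𝓝[>] 0)

/-! ### Finite counting measures -/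

/-- The space of finite counting measures on `S`: the measures `∑_{i < m} δ_{x i}`. -/
structure CountingMeasure (S : Type*) [MeasurableSpace S] where
  /-- The underlying measure. -/
  toMeasure : Measure S
  /-- It is a finite sum of Dirac measures. -/
  exists_points : ∃ (m : ℕ) (x : Fin m → S), toMeasure = ∑ i, Measure.dirac (x i)

namespace CountingMeasure

variable {S : Type*} [MeasurableSpace S]

/-- The cardinality `|μ| = μ(S)`. -/
def card (μ : CountingMeasure S) : ℕ := μ.exists_points.choose

/-- An enumeration `x_1, …, x_{|μ|}` of the points of `μ`. -/
def points (μ : CountingMeasure S) : Fin μ.card → S := μ.exists_points.choose_spec.choose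

theorem toMeasure_eq (μ : CountingMeasure S) :
    μ.toMeasure = ∑ i, Measure.dirac (μ.points i) :=
  μ.exists_points.choose_spec.choose_spec

theorem toMeasure_univ (μ : CountingMeasure S) : μ.toMeasure Set.univ = μ.card := by
  rw [toMeasure_eq]
  simp

/-- The vague topology: the smallest topology for which `μ ↦ ∫ f dμ` is continuous for all
continuous real functions `f` on `S` with compact support. -/
instance [TopologicalSpace S] : TopologicalSpace (CountingMeasure S) :=
  ⨅ f : C_c(S, ℝ), TopologicalSpace.induced (fun μ => ∫ x, f x ∂μ.toMeasure) inferInstance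

/-- The `σ`-algebra generated by the vague topology. -/
instance [TopologicalSpace S] : MeasurableSpace (CountingMeasure S) :=
  borel (CountingMeasure S)

instance [TopologicalSpace S] : BorelSpace (CountingMeasure S) := ⟨rfl⟩

/-- The points of `μ`, followed by `k - |μ|` copies of the additional point `none`. -/
def paddedPoints (μ : CountingMeasure S) (k : ℕ) : Fin k → Option S :=
  fun i => if h : (i : ℕ) < μ.card then some (μ.points ⟨i, h⟩) else none

/-- The metric `D₁` on finite counting measures. The space `S ∪ {s_α}` is `Option S`, with
`s_α = none`. The measure with fewer points is filled up with copies of `s_α` until both have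
`m = max |μ| |ν|` points, and the total distance is minimized over all bijections. -/
def D₁ [MetricSpace (Option S)] (μ ν : CountingMeasure S) : ℝ :=
  ⨅ π : Equiv.Perm (Fin (max μ.card ν.card)),
    ∑ i, dist (μ.paddedPoints (max μ.card ν.card) i) (ν.paddedPoints (max μ.card ν.card) (π i))

end CountingMeasure

/-! ### Wasserstein distance and empirical measures -/

/-- The measures on the product whose marginals are `Q₁` and `Q₂`. -/
def couplings {N : Type*} [MeasurableSpace N] (Q₁ Q₂ : Measure N) : Set (Measure (N × N)) :=
  {γ | γ.map Prod.fst = Q₁ ∧ γ.map Prod.snd = Q₂}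

/-- The Wasserstein distance of order `p` with respect to `D₁`, with values in `[0, ∞]`. -/
def wassersteinDist {S : Type*} [TopologicalSpace S] [MeasurableSpace S] [MetricSpace (Option S)]
    (p : ℝ) (Q₁ Q₂ : Measure (CountingMeasure S)) : ℝ≥0∞ :=
  (⨅ γ ∈ couplings Q₁ Q₂, ∫⁻ z, ENNReal.ofReal (CountingMeasure.D₁ z.1 z.2 ^ p) ∂γ) ^ (1 / p)

/-- The empirical measure `(1/n) ∑_{i < n} δ_{y i}`. -/
def empiricalMeasure {N : Type*} [MeasurableSpace N] {n : ℕ} (y : Fin n → N) : Measure N :=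
  (n : ℝ≥0∞)⁻¹ • ∑ i, Measure.dirac (y i)

end

/-!
The expected distance between an empirical law and the true law of a point process is bounded by
discretizing the space of counting measures at one scale per cardinality.

Fix for every cardinality `m` a labelling of `S` by `k m` labels whose classes have diameter at
most `δ m`. Counting measures with `m` points are sorted into cells according to the multiset of
the labels of their points: there are at most `k m ^ m` cells of cardinality `m`
(`card_sym_fin_le`), and two measures of the same cell are at `D₁`-distance at most `m * δ m`
(`D₁_le_of_mem_cell`). The mass that the two laws share in a cell is coupled within that cell and
the rest by a product measure (`exists_coupling_lintegral_le`). The excess mass in a cell is a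
deviation of an empirical frequency from its mean, so it is at most of the order of its standard
deviation; summing over the cells with the Cauchy–Schwarz inequality gives, for
`q m = P(|η| = m)` and `Δ` a bound for all distances in `S ∪ {s_α}`,
`E W_p ≤ (∑ m, (m δ m) ^ p q m + (m Δ) ^ p √(k m ^ m q m / n)) ^ (1 / p)`
(`lintegral_wassersteinDist_le`).

If `d` exceeds the Minkowski dimension, `k m ≤ (δ m) ^ (-d)` is possible for small `δ m`
(`exists_label_of_minkowskiDim_lt`). Both terms are balanced by
`δ m = (exp (λ m) / n) ^ (1 / (2 p + d m))`, and then have order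
`exp (-λ m - p log n / (2 p + d m))` up to a power of `m`, which by the inequality of arithmetic
and geometric means is at most a constant times `exp (-2 √(p λ / d) √(log n))`, uniformly in `m`
(`cell_error_le_of_scale`). Cardinalities beyond a large multiple of `√(log n)` are negligible even
with a single cell (`cell_error_le_of_single`).

Since `κ > 0`, a value `d = dim S + κ / 2` is available, and the gain in the exponent compared with
`dim S + κ` absorbs every constant and the sum over `m`, once `n` is large depending on all the
data (`eventually_lintegral_wassersteinDist_le`). Hence the constant `C = 1` suffices, and the
logarithmic factor in the first bound is not needed.
-/

/-! ### Measurability of counting functionals for the vague topology -/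

namespace CountingMeasure

section Measurability

variable {S : Type*} [MetricSpace S] [CompactSpace S] [MeasurableSpace S]

instance (μ : CountingMeasure S) : IsFiniteMeasure μ.toMeasure :=
  ⟨by rw [μ.toMeasure_univ]; exact ENNReal.natCast_lt_top _⟩

/-- On a compact space every continuous function has compact support, so all integrals of
continuous functions are vaguely continuous. -/
theorem continuous_integral (f : C(S, ℝ)) :
    Continuous fun μ : CountingMeasure S => ∫ x, f x ∂μ.toMeasure := by
  let g : C_c(S, ℝ) := ⟨f, HasCompactSupport.of_compactSpace f⟩
  exact continuous_iInf_dom (i := g) continuous_induced_dom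

theorem measurable_lintegral [BorelSpace S] (f : C(S, ℝ≥0)) :
    Measurable fun μ : CountingMeasure S => ∫⁻ x, f x ∂μ.toMeasure := by
  let g : C(S, ℝ) := ⟨fun x => f x, by fun_prop⟩
  have h : (fun μ : CountingMeasure S => ∫⁻ x, f x ∂μ.toMeasure) =
      fun μ => ENNReal.ofReal (∫ x, g x ∂μ.toMeasure) := by
    funext μ
    rw [ofReal_integral_eq_lintegral_ofReal]
    · simp [g]
    · exact g.continuous.integrable_of_hasCompactSupport (HasCompactSupport.of_compactSpace _)
    · exact Eventually.of_forall fun x => NNReal.coe_nonneg _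
  rw [h]
  exact (continuous_integral g).measurable.ennreal_ofReal

variable [BorelSpace S]

/-- Closed sets form a generating `π`-system, and the mass of a closed set is a limit of integrals
of continuous functions. -/
theorem measurable_toMeasure : Measurable fun μ : CountingMeasure S => μ.toMeasure := by
  have key : ∀ F : Set S, IsClosed F →
      Measurable fun μ : CountingMeasure S => μ.toMeasure F := by
    intro F hF
    have hpos : ∀ n : ℕ, (0 : ℝ) < 1 / ((n : ℝ) + 1) := fun n => Nat.one_div_pos_of_nat
    refine measurable_of_tendsto_metrizable
      (f := fun n (μ : CountingMeasure S) =>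
        ∫⁻ x, (thickenedIndicator (hpos n) F x : ℝ≥0∞) ∂μ.toMeasure) (fun n => ?_) ?_
    · exact measurable_lintegral (thickenedIndicator (hpos n) F).toContinuousMap
    · rw [tendsto_pi_nhds]
      intro μ
      exact tendsto_lintegral_thickenedIndicator_of_isClosed μ.toMeasure hF hpos
        tendsto_one_div_add_atTop_nhds_zero_nat
  refine Measurable.measure_of_isPiSystem
    ((BorelSpace.measurable_eq (α := S)).trans (borel_eq_generateFrom_isClosed (α := S)))
    isPiSystem_isClosed (fun F hF => key F hF) (key _ isClosed_univ)

theorem measurable_eval {B : Set S} (hB : MeasurableSet B) :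
    Measurable fun μ : CountingMeasure S => μ.toMeasure B :=
  (Measure.measurable_coe hB).comp measurable_toMeasure

theorem measurable_card : Measurable fun μ : CountingMeasure S => μ.card := by
  refine measurable_to_countable' fun m => ?_
  have : (fun μ : CountingMeasure S => μ.card) ⁻¹' {m} =
      (fun μ : CountingMeasure S => μ.toMeasure Set.univ) ⁻¹' {(m : ℝ≥0∞)} := by
    ext μ
    simp [toMeasure_univ]
  rw [this]
  exact measurable_eval MeasurableSet.univ (measurableSet_singleton _)

end Measurability

/-! ### Cells: counting measures with prescribed labels -/

section Cells

variable {S : Type*} [MeasurableSpace S]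

/-- The cell attached to a labelling `ℓ : S → κ` and a multiset `z` of `m` labels: the counting
measures with `m` points whose labels, with multiplicity, are `z`. -/
def cell {κ : Type*} (ℓ : S → κ) {m : ℕ} (z : Sym κ m) : Set (CountingMeasure S) :=
  {μ | μ.card = m ∧ Finset.univ.val.map (fun i => ℓ (μ.points i)) = (z : Multiset κ)}

variable {κ : Type*} {m : ℕ}

/-- The multiplicity of a label is the mass of the set of points carrying it. -/
theorem toMeasure_preimage_singleton [DecidableEq κ] [MeasurableSpace κ]
    [MeasurableSingletonClass κ] {ℓ : S → κ} (hℓ : Measurable ℓ) (μ : CountingMeasure S) (j : κ) :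
    μ.toMeasure (ℓ ⁻¹' {j}) =
      ((Finset.univ.val.map fun i => ℓ (μ.points i)).count j : ℝ≥0∞) := by
  rw [toMeasure_eq, Measure.finsetSum_apply, Multiset.count_map, ← Finset.filter_val,
    Finset.card_val, Finset.card_filter, Nat.cast_sum]
  refine Finset.sum_congr rfl fun i _ => ?_
  rw [Measure.dirac_apply' _ (hℓ (measurableSet_singleton j))]
  by_cases h : ℓ (μ.points i) = j
  · simp [h]
  · simp [h, Ne.symm h]

theorem measurableSet_cell {S : Type*} [MetricSpace S] [CompactSpace S] [MeasurableSpace S]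
    [BorelSpace S] [Countable κ] [MeasurableSpace κ] [MeasurableSingletonClass κ] {ℓ : S → κ}
    (hℓ : Measurable ℓ) (z : Sym κ m) : MeasurableSet (cell ℓ z) := by
  classical
  have : cell ℓ z = ((fun μ : CountingMeasure S => μ.card) ⁻¹' {m}) ∩
      ⋂ j, (fun μ : CountingMeasure S => μ.toMeasure (ℓ ⁻¹' {j})) ⁻¹'
        {((z : Multiset κ).count j : ℝ≥0∞)} := by
    ext μ
    simp only [cell, Set.mem_ofPred_eq, Set.mem_inter_iff, Set.mem_preimage,
      Set.mem_singleton_iff, Set.mem_iInter, toMeasure_preimage_singleton hℓ, Nat.cast_inj,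
      Multiset.ext]
  rw [this]
  exact (measurable_card (measurableSet_singleton _)).inter (MeasurableSet.iInter fun j =>
    measurable_eval (hℓ (measurableSet_singleton j)) (measurableSet_singleton _))

variable {k : ℕ → ℕ}

theorem exists_mem_cell (ℓ : ∀ m, S → Fin (k m)) (μ : CountingMeasure S) :
    ∃ z : Sym (Fin (k μ.card)) μ.card, μ ∈ cell (ℓ μ.card) z :=
  ⟨⟨Finset.univ.val.map fun i => ℓ μ.card (μ.points i), by simp⟩, rfl, rfl⟩

theorem iUnion_cell (ℓ : ∀ m, S → Fin (k m)) :
    ⋃ j : (Σ m, Sym (Fin (k m)) m), cell (ℓ j.1) j.2 = Set.univ := by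
  refine Set.eq_univ_of_forall fun μ => ?_
  obtain ⟨z, hz⟩ := exists_mem_cell ℓ μ
  exact Set.mem_iUnion.2 ⟨⟨_, z⟩, hz⟩

theorem pairwise_disjoint_cell (ℓ : ∀ m, S → Fin (k m)) :
    Pairwise (Function.onFun Disjoint
      fun j : (Σ m, Sym (Fin (k m)) m) => cell (ℓ j.1) j.2) := by
  rintro ⟨m, z⟩ ⟨m', z'⟩ hne
  refine Set.disjoint_left.2 fun μ hμ hμ' => hne ?_
  obtain ⟨h1, h2⟩ := hμ
  obtain ⟨h1', h2'⟩ := hμ'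
  dsimp only at h1 h1' h2 h2'
  obtain rfl : m = m' := h1.symm.trans h1'
  exact congrArg (Sigma.mk m) (Subtype.ext (h2.symm.trans h2'))

/-- A multiset of `m` labels is the image of some `m`-tuple, so there are at most `k ^ m` cells of
cardinality `m`. -/
theorem card_sym_fin_le (k m : ℕ) : Fintype.card (Sym (Fin k) m) ≤ k ^ m := by
  have h : Function.Surjective
      (Sym.ofVector : List.Vector (Fin k) m → Sym (Fin k) m) := by
    rintro ⟨s, hs⟩
    induction s using Quotient.inductionOn with
    | h l => exact ⟨⟨l, hs⟩, rfl⟩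
  simpa using Fintype.card_le_of_surjective _ h

end Cells

/-! ### Bounds for the metric `D₁` -/

section Distance

variable {S : Type*} [MeasurableSpace S] [MetricSpace (Option S)]

theorem D₁_nonneg (μ ν : CountingMeasure S) : 0 ≤ D₁ μ ν :=
  Real.iInf_nonneg fun _ => Finset.sum_nonneg fun _ _ => dist_nonneg

theorem D₁_le (μ ν : CountingMeasure S) (π : Equiv.Perm (Fin (max μ.card ν.card))) :
    D₁ μ ν ≤ ∑ i, dist (μ.paddedPoints (max μ.card ν.card) i)
      (ν.paddedPoints (max μ.card ν.card) (π i)) :=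
  ciInf_le (Set.finite_range _).bddBelow π

theorem D₁_le_max_mul {Δ : ℝ} (hΔ : ∀ x y : Option S, dist x y ≤ Δ) (μ ν : CountingMeasure S) :
    D₁ μ ν ≤ (max μ.card ν.card : ℕ) * Δ := by
  refine (D₁_le μ ν 1).trans ((Finset.sum_le_sum fun i _ => hΔ _ _).trans ?_)
  simp

theorem D₁_le_of_equiv {δ : ℝ} {μ ν : CountingMeasure S} (e : Fin μ.card ≃ Fin ν.card)
    (h : ∀ i, dist (some (μ.points i)) (some (ν.points (e i)) : Option S) ≤ δ) :
    D₁ μ ν ≤ μ.card * δ := by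
  have hc : μ.card = ν.card := by simpa using Fintype.card_congr e
  have h1 : max μ.card ν.card = μ.card := by omega
  have h2 : max μ.card ν.card = ν.card := by omega
  refine (D₁_le μ ν ((finCongr h1).trans (e.trans (finCongr h2.symm)))).trans
    ((Finset.sum_le_sum fun i _ => (?_ : _ ≤ δ)).trans ?_)
  · have hi : (i : ℕ) < μ.card := i.2.trans_eq h1
    simp only [paddedPoints, Equiv.trans_apply, finCongr_apply, Fin.val_cast, hi, Fin.is_lt,
      dite_true]
    exact h ⟨i, hi⟩
  · simp [← hc]

/-- Two counting measures of the same cell are matched point by point along equal labels. -/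
theorem D₁_le_of_mem_cell {κ : Type*} {m : ℕ} {δ : ℝ} {ℓ : S → κ}
    (hℓ : ∀ x y, ℓ x = ℓ y → dist (some x) (some y : Option S) ≤ δ) {z : Sym κ m}
    {μ ν : CountingMeasure S} (hμ : μ ∈ cell ℓ z) (hν : ν ∈ cell ℓ z) :
    D₁ μ ν ≤ m * δ := by
  classical
  have hcount : ∀ c, Fintype.card {i // ℓ (μ.points i) = c} =
      Fintype.card {i // ℓ (ν.points i) = c} := by
    intro c
    have h := congrArg (Multiset.count c) (hμ.2.trans hν.2.symm)
    rw [Multiset.count_map, Multiset.count_map, ← Finset.filter_val, ← Finset.filter_val,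
      Finset.card_val, Finset.card_val] at h
    simpa [Fintype.card_subtype, eq_comm] using h
  have key := D₁_le_of_equiv
    (Equiv.ofFiberEquiv (f := fun i => ℓ (μ.points i)) (g := fun i => ℓ (ν.points i))
      fun c => Fintype.equivOfCardEq (hcount c)) (δ := δ) fun i =>
      hℓ _ _ (Equiv.ofFiberEquiv_map (f := fun i => ℓ (μ.points i))
        (g := fun i => ℓ (ν.points i)) _ i).symm
  rwa [hμ.1] at key

end Distance

end CountingMeasure

/-! ### Couplings adapted to a countable partition -/

section Coupling

variable {N J : Type*} [MeasurableSpace N] {E : J → Set N}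

theorem smul_cond_eq_restrict (Q : Measure N) [IsFiniteMeasure Q] (A : Set N) :
    Q A • Q[|A] = Q.restrict A := by
  by_cases h : Q A = 0
  · rw [h, zero_smul, Measure.restrict_eq_zero.2 h]
  · rw [ProbabilityTheory.cond, smul_smul, ENNReal.mul_inv_cancel h (measure_ne_top Q A), one_smul]

/-- The bound `w ≤ Q A` makes `w` vanish when `Q A = 0`, where `Q[|A]` is the zero measure. -/
theorem smul_cond_univ {Q : Measure N} [IsFiniteMeasure Q] {A : Set N} {w : ℝ≥0∞}
    (hw : w ≤ Q A) : w * Q[|A] Set.univ = w := by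
  by_cases h : Q A = 0
  · simp [nonpos_iff_eq_zero.1 (hw.trans_eq h)]
  · have := cond_isProbabilityMeasure h
    rw [measure_univ, mul_one]

/-- A finite measure splits into a part with mass `w j` in the `j`-th cell and the remainder. -/
theorem sum_smul_cond_add [Countable J] (hE : ∀ j, MeasurableSet (E j))
    (hdisj : Pairwise (Function.onFun Disjoint E)) (hun : ⋃ j, E j = Set.univ)
    (Q : Measure N) [IsFiniteMeasure Q] {w : J → ℝ≥0∞} (hw : ∀ j, w j ≤ Q (E j)) :
    (Measure.sum fun j => w j • Q[|E j]) + (Measure.sum fun j => (Q (E j) - w j) • Q[|E j]) =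
      Q := by
  rw [Measure.sum_add_sum]
  simp only [← add_smul, add_tsub_cancel_of_le (hw _), smul_cond_eq_restrict]
  rw [← Measure.restrict_iUnion hdisj hE, hun, Measure.restrict_univ]

theorem sum_smul_cond_univ {Q : Measure N} [IsFiniteMeasure Q] {w : J → ℝ≥0∞}
    (hw : ∀ j, w j ≤ Q (E j)) :
    (Measure.sum fun j => w j • Q[|E j]) Set.univ = ∑' j, w j := by
  rw [Measure.sum_apply _ MeasurableSet.univ]
  simp only [Measure.smul_apply, smul_eq_mul, smul_cond_univ (hw _)]

/-- The mass that two probability measures have in common in each cell of a partition is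
transported within that cell, at cost at most `a j`; the remaining mass is transported by a product
measure, at cost at most `b i + b j`. No measurability of the cost `c` is needed. -/
theorem exists_coupling_lintegral_le [Countable J] (hE : ∀ j, MeasurableSet (E j))
    (hdisj : Pairwise (Function.onFun Disjoint E)) (hun : ⋃ j, E j = Set.univ)
    (Q₁ Q₂ : Measure N) [IsProbabilityMeasure Q₁] [IsProbabilityMeasure Q₂] {a b : J → ℝ≥0∞}
    {c : N × N → ℝ≥0∞} (hcell : ∀ j, ∀ x ∈ E j, ∀ y ∈ E j, c (x, y) ≤ a j)
    (hcross : ∀ i j, ∀ x ∈ E i, ∀ y ∈ E j, c (x, y) ≤ b i + b j) :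
    ∃ γ ∈ couplings Q₁ Q₂, ∫⁻ z, c z ∂γ ≤ ∑' j, a j * Q₂ (E j) +
      ∑' j, b j * ((Q₁ (E j) - Q₂ (E j)) + (Q₂ (E j) - Q₁ (E j))) := by
  classical
  set m : J → ℝ≥0∞ := fun j => min (Q₁ (E j)) (Q₂ (E j)) with hm
  have hm1 : ∀ j, m j ≤ Q₁ (E j) := fun j => min_le_left _ _
  have hm2 : ∀ j, m j ≤ Q₂ (E j) := fun j => min_le_right _ _
  set R₁ : Measure N := Measure.sum fun j => (Q₁ (E j) - m j) • Q₁[|E j] with hR₁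
  set R₂ : Measure N := Measure.sum fun j => (Q₂ (E j) - m j) • Q₂[|E j] with hR₂
  have hd1 := sum_smul_cond_add hE hdisj hun Q₁ hm1
  have hd2 := sum_smul_cond_add hE hdisj hun Q₂ hm2
  have hu1 : (∑' j, m j) + R₁ Set.univ = 1 := by
    rw [← sum_smul_cond_univ hm1, ← Measure.add_apply, hd1, measure_univ]
  have hu2 : (∑' j, m j) + R₂ Set.univ = 1 := by
    rw [← sum_smul_cond_univ hm2, ← Measure.add_apply, hd2, measure_univ]
  have hmtop : (∑' j, m j) ≠ ∞ := fun h => by simp [h] at hu1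
  -- Both remainders have the same mass `r`.
  set r := R₁ Set.univ with hr
  have hr2 : R₂ Set.univ = r := by
    rw [← hu2] at hu1
    exact ((ENNReal.add_right_inj hmtop).1 hu1).symm
  have hrle : r ≤ 1 := le_add_self.trans_eq hu1
  have hrtop : r ≠ ∞ := ne_top_of_le_ne_top ENNReal.one_ne_top hrle
  have : IsFiniteMeasure R₁ := ⟨hrtop.lt_top⟩
  have : IsFiniteMeasure R₂ := ⟨by rw [hr2]; exact hrtop.lt_top⟩
  have hone : ∀ R : Measure N, R Set.univ = r → r⁻¹ • (r • R) = R := by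
    intro R hR
    by_cases h0 : r = 0
    · rw [h0] at hR
      simp [Measure.measure_univ_eq_zero.1 hR]
    · rw [smul_smul, ENNReal.inv_mul_cancel h0 hrtop, one_smul]
  have hfst : (r⁻¹ • R₁.prod R₂).map Prod.fst = R₁ := by
    rw [Measure.map_smul, Measure.map_fst_prod, hr2, hone R₁ rfl]
  have hsnd : (r⁻¹ • R₁.prod R₂).map Prod.snd = R₂ := by
    rw [Measure.map_smul, Measure.map_snd_prod, ← hr, hone R₂ hr2]
  refine ⟨(Measure.sum fun j => m j • (Q₁[|E j]).prod (Q₂[|E j])) + r⁻¹ • R₁.prod R₂,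
    ⟨?_, ?_⟩, ?_⟩
  · rw [Measure.map_add _ _ measurable_fst, hfst, Measure.map_sum measurable_fst.aemeasurable]
    simp only [Measure.map_smul, Measure.map_fst_prod, smul_smul, smul_cond_univ (hm2 _)]
    exact hd1
  · rw [Measure.map_add _ _ measurable_snd, hsnd, Measure.map_sum measurable_snd.aemeasurable]
    simp only [Measure.map_smul, Measure.map_snd_prod, smul_smul, smul_cond_univ (hm1 _)]
    exact hd2
  · have hmem : ∀ Q : Measure N, ∀ j, ∀ᵐ x ∂Q[|E j], x ∈ E j := fun Q j => ae_cond_mem (hE j)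
    have hprob : ∀ (Q : Measure N) [IsFiniteMeasure Q] (j : J), Q[|E j] Set.univ ≤ 1 :=
      fun Q _ j => prob_le_one
    rw [lintegral_add_measure, lintegral_sum_measure]
    refine add_le_add (ENNReal.tsum_le_tsum fun j => ?_) ?_
    · rw [lintegral_smul_measure, smul_eq_mul, mul_comm (a j)]
      refine mul_le_mul' (hm2 j) ?_
      have hae : ∀ᵐ z ∂(Q₁[|E j]).prod (Q₂[|E j]), c z ≤ a j := by
        filter_upwards [Measure.quasiMeasurePreserving_fst.ae (hmem Q₁ j),
          Measure.quasiMeasurePreserving_snd.ae (hmem Q₂ j)] with z h1 h2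
        exact hcell j _ h1 _ h2
      refine (lintegral_mono_ae hae).trans ?_
      rw [lintegral_const, ← Set.univ_prod_univ, Measure.prod_prod]
      exact mul_le_of_le_one_right' (mul_le_one' (hprob Q₁ j) (hprob Q₂ j))
    · -- `h` takes the value `b j` on the `j`-th cell.
      set h : N → ℝ≥0∞ := fun x => ∑' j, (E j).indicator (fun _ => b j) x with hh
      have hmeas : Measurable h := Measurable.tsum fun j =>
        measurable_const.indicator (hE j)
      have hval : ∀ j, ∀ x ∈ E j, h x = b j := by
        intro j x hx
        rw [hh]
        dsimp only
        rw [tsum_eq_single j]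
        · simp [hx]
        · intro i hi
          exact Set.indicator_of_notMem (fun hxi => Set.disjoint_left.1 (hdisj hi) hxi hx) _
      have hle : ∀ z : N × N, c z ≤ h z.1 + h z.2 := by
        intro z
        obtain ⟨i, hi⟩ := Set.mem_iUnion.1 (hun ▸ Set.mem_univ z.1)
        obtain ⟨j, hj⟩ := Set.mem_iUnion.1 (hun ▸ Set.mem_univ z.2)
        rw [hval i _ hi, hval j _ hj]
        exact hcross i j _ hi _ hj
      have hint : ∀ (Q : Measure N) [IsFiniteMeasure Q] (w : J → ℝ≥0∞),
          ∫⁻ x, h x ∂(Measure.sum fun j => w j • Q[|E j]) ≤ ∑' j, b j * w j := by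
        intro Q _ w
        rw [lintegral_sum_measure]
        refine ENNReal.tsum_le_tsum fun j => ?_
        rw [lintegral_smul_measure, smul_eq_mul, mul_comm (b j)]
        refine mul_le_mul' le_rfl ?_
        rw [lintegral_congr_ae ((hmem Q j).mono fun x hx => hval j x hx), lintegral_const]
        exact mul_le_of_le_one_right' (hprob Q j)
      calc ∫⁻ z, c z ∂(r⁻¹ • R₁.prod R₂)
          ≤ ∫⁻ z, (h z.1 + h z.2) ∂(r⁻¹ • R₁.prod R₂) := lintegral_mono hle
        _ = ∫⁻ x, h x ∂(R₁) + ∫⁻ x, h x ∂(R₂) := by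
            have e1 : ∫⁻ z, h z.1 ∂(r⁻¹ • R₁.prod R₂) = ∫⁻ x, h x ∂(R₁) := by
              rw [← lintegral_map hmeas measurable_fst, hfst]
            have e2 : ∫⁻ z, h z.2 ∂(r⁻¹ • R₁.prod R₂) = ∫⁻ x, h x ∂(R₂) := by
              rw [← lintegral_map hmeas measurable_snd, hsnd]
            rw [← e1, ← e2]
            exact lintegral_add_left (hmeas.comp measurable_fst) _
        _ ≤ ∑' j, b j * (Q₁ (E j) - m j) + ∑' j, b j * (Q₂ (E j) - m j) :=
            add_le_add (hint Q₁ _) (hint Q₂ _)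
        _ = _ := by
            rw [← ENNReal.tsum_add]
            refine tsum_congr fun j => ?_
            rw [← mul_add]
            simp only [hm, tsub_min]
            rw [min_comm, tsub_min]

end Coupling

/-! ### Empirical measures -/

section Empirical

variable {N Ω : Type*} [MeasurableSpace N] [MeasurableSpace Ω] {n : ℕ}

theorem empiricalMeasure_apply (y : Fin n → N) {A : Set N} (hA : MeasurableSet A) :
    empiricalMeasure y A = (n : ℝ≥0∞)⁻¹ * ∑ i, A.indicator 1 (y i) := by
  simp [empiricalMeasure, Measure.finsetSum_apply, Measure.dirac_apply' _ hA]

theorem isProbabilityMeasure_empiricalMeasure (hn : n ≠ 0) (y : Fin n → N) :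
    IsProbabilityMeasure (empiricalMeasure y) := by
  constructor
  rw [empiricalMeasure_apply y MeasurableSet.univ]
  simp [ENNReal.inv_mul_cancel (Nat.cast_ne_zero.2 hn) (ENNReal.natCast_ne_top n)]

theorem measurable_empiricalMeasure_apply {X : Fin n → Ω → N} (hX : ∀ i, Measurable (X i))
    {A : Set N} (hA : MeasurableSet A) :
    Measurable fun ω => empiricalMeasure (fun i => X i ω) A := by
  simp only [empiricalMeasure_apply _ hA]
  refine (Finset.measurable_sum _ fun i _ => ?_).const_mul _
  exact (measurable_one.indicator hA).comp (hX i)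

/-- The mean deviation of an empirical frequency is at most its standard deviation. -/
theorem lintegral_empiricalMeasure_sub_le (hn : n ≠ 0) {P : Measure Ω} [IsProbabilityMeasure P]
    {Q : Measure N} {X : Fin n → Ω → N} (hX : ∀ i, Measurable (X i)) (hindep : iIndepFun X P)
    (hlaw : ∀ i, P.map (X i) = Q) {A : Set N} (hA : MeasurableSet A) :
    ∫⁻ ω, ((empiricalMeasure (fun i => X i ω) A - Q A) +
      (Q A - empiricalMeasure (fun i => X i ω) A)) ∂P ≤ ENNReal.ofReal √(Q.real A / n) := by
  have hnR : (0 : ℝ) < n := Nat.cast_pos.2 (Nat.pos_of_ne_zero hn)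
  have : IsProbabilityMeasure Q := by
    rw [← hlaw ⟨0, Nat.pos_of_ne_zero hn⟩]
    exact Measure.isProbabilityMeasure_map (hX _).aemeasurable
  set g : N → ℝ := A.indicator 1 with hg
  have hgm : Measurable g := measurable_one.indicator hA
  have hg01 : ∀ x, g x = 0 ∨ g x = 1 := fun x => by by_cases h : x ∈ A <;> simp [hg, h]
  have hgb : ∀ x, ‖g x‖ ≤ 1 := fun x => by rcases hg01 x with h | h <;> simp [h]
  set Y : Fin n → Ω → ℝ := fun i ω => g (X i ω) with hY
  have hYm : ∀ i, Measurable (Y i) := fun i => hgm.comp (hX i)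
  have hYL : ∀ i, MemLp (Y i) 2 P := fun i =>
    MemLp.of_bound (hYm i).aestronglyMeasurable 1 (Eventually.of_forall fun ω => hgb _)
  have hYE : ∀ i, P[Y i] = Q.real A := by
    intro i
    rw [← hlaw i, ← integral_indicator_one hA,
      integral_map (hX i).aemeasurable (hgm.aestronglyMeasurable)]
  have hYV : ∀ i, Var[Y i; P] ≤ Q.real A := by
    intro i
    refine (variance_le_expectation_sq (hYm i).aestronglyMeasurable).trans_eq ?_
    rw [← hYE i]
    congr 1
    funext ω
    rcases hg01 (X i ω) with h | h <;> simp [hY, h]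
  set Z : Ω → ℝ := fun ω => (n : ℝ)⁻¹ * (∑ i, Y i) ω with hZ
  have hsum : MemLp (∑ i, Y i) 2 P := memLp_finsetSum' _ fun i _ => hYL i
  have hZL : MemLp Z 2 P := hsum.const_mul _
  have hZE : P[Z] = Q.real A := by
    rw [hZ, integral_const_mul]
    simp only [Finset.sum_apply]
    rw [integral_finsetSum _ fun i _ => (hYL i).integrable one_le_two]
    simp only [hYE, Finset.sum_const, Finset.card_univ, Fintype.card_fin, nsmul_eq_mul]
    field_simp
  have hZV : Var[Z; P] ≤ Q.real A / n := by
    rw [hZ, variance_const_mul, IndepFun.variance_sum (fun i _ => hYL i) fun i _ j _ hij =>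
      (hindep.indepFun hij).comp hgm hgm]
    refine (mul_le_mul_of_nonneg_left (Finset.sum_le_sum fun i _ => hYV i)
      (by positivity)).trans_eq ?_
    simp only [Finset.sum_const, Finset.card_univ, Fintype.card_fin, nsmul_eq_mul]
    field_simp
  have hpt : ∀ ω, (empiricalMeasure (fun i => X i ω) A - Q A) +
      (Q A - empiricalMeasure (fun i => X i ω) A) = ‖Z ω - P[Z]‖ₑ := by
    intro ω
    have h1 : empiricalMeasure (fun i => X i ω) A = ENNReal.ofReal (Z ω) := by
      rw [empiricalMeasure_apply _ hA, hZ]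
      dsimp only
      rw [ENNReal.ofReal_mul (by positivity), ENNReal.ofReal_inv_of_pos hnR,
        ENNReal.ofReal_natCast, Finset.sum_apply, ENNReal.ofReal_sum_of_nonneg]
      · congr 1
        refine Finset.sum_congr rfl fun i _ => ?_
        by_cases h : X i ω ∈ A <;> simp [hY, hg, h]
      · intro i _
        rcases hg01 (X i ω) with h | h <;> simp [hY, h]
    have h0 : 0 ≤ Z ω := by
      refine mul_nonneg (by positivity) ?_
      rw [Finset.sum_apply]
      refine Finset.sum_nonneg fun i _ => ?_
      rcases hg01 (X i ω) with h | h <;> simp [hY, h]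
    have h2 : Q A = ENNReal.ofReal (Q.real A) := (ofReal_measureReal).symm
    rw [h1, h2, hZE, ← ENNReal.ofReal_sub _ measureReal_nonneg, ← ENNReal.ofReal_sub _ h0,
      Real.enorm_eq_ofReal_abs]
    rcases le_total (Z ω) (Q.real A) with h | h
    · rw [ENNReal.ofReal_of_nonpos (sub_nonpos.2 h), zero_add, abs_sub_comm,
        abs_of_nonneg (sub_nonneg.2 h)]
    · rw [ENNReal.ofReal_of_nonpos (sub_nonpos.2 h), add_zero, abs_of_nonneg (sub_nonneg.2 h)]
  simp only [hpt]
  have hLp : MemLp (fun ω => Z ω - P[Z]) 2 P := hZL.sub (memLp_const _)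
  calc ∫⁻ ω, ‖Z ω - P[Z]‖ₑ ∂P = eLpNorm (fun ω => Z ω - P[Z]) 1 P :=
        eLpNorm_one_eq_lintegral_enorm.symm
    _ ≤ eLpNorm (fun ω => Z ω - P[Z]) 2 P :=
        eLpNorm_le_eLpNorm_of_exponent_le one_le_two hLp.1
    _ = (eVar[Z; P]) ^ (1 / 2 : ℝ) := by
        rw [eLpNorm_eq_lintegral_rpow_enorm_toReal two_ne_zero ENNReal.ofNat_ne_top]
        simp [evariance]
    _ = ENNReal.ofReal √(Var[Z; P]) := by
        rw [← ofReal_variance hZL, Real.sqrt_eq_rpow,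
          ENNReal.ofReal_rpow_of_nonneg (variance_nonneg _ _) (by positivity)]
    _ ≤ _ := ENNReal.ofReal_le_ofReal (Real.sqrt_le_sqrt hZV)

end Empirical

/-! ### The expected Wasserstein distance in terms of a family of labellings -/

section Wasserstein

theorem lintegral_rpow_inv_le {Ω : Type*} [MeasurableSpace Ω] {P : Measure Ω}
    [IsProbabilityMeasure P] {p : ℝ} (hp : 1 ≤ p) {F : Ω → ℝ≥0∞} (hF : AEMeasurable F P) :
    ∫⁻ ω, F ω ^ (1 / p) ∂P ≤ (∫⁻ ω, F ω ∂P) ^ (1 / p) := by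
  have h := eLpNorm'_le_eLpNorm'_of_exponent_le (f := fun ω => F ω ^ (1 / p)) zero_lt_one hp P
    (hF.pow_const _).aestronglyMeasurable
  have hp0 : p ≠ 0 := by positivity
  simpa [eLpNorm', ← ENNReal.rpow_mul, hp0] using h

variable {S : Type*} [MetricSpace S] [CompactSpace S] [MeasurableSpace S] [BorelSpace S]

open CountingMeasure

theorem measurableSet_card_eq (m : ℕ) : MeasurableSet {μ : CountingMeasure S | μ.card = m} :=
  measurable_card (measurableSet_singleton m)

variable {k : ℕ → ℕ} {ℓ : ∀ m, S → Fin (k m)} {Q : Measure (CountingMeasure S)}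
  [IsProbabilityMeasure Q]

theorem sum_measureReal_cell (hℓ : ∀ m, Measurable (ℓ m)) (m : ℕ) :
    ∑ z : Sym (Fin (k m)) m, Q.real (cell (ℓ m) z) = Q.real {μ | μ.card = m} := by
  have hU : {μ : CountingMeasure S | μ.card = m} =
      ⋃ z ∈ (Finset.univ : Finset (Sym (Fin (k m)) m)), cell (ℓ m) z := by
    ext μ
    simp only [Set.mem_ofPred_eq, Finset.mem_univ, Set.iUnion_true, Set.mem_iUnion]
    constructor
    · rintro rfl
      exact exists_mem_cell ℓ μ
    · rintro ⟨z, hz⟩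
      exact hz.1
  rw [hU, measureReal_biUnion_finset]
  · intro z _ z' _ hne
    exact pairwise_disjoint_cell ℓ (i := ⟨m, z⟩) (j := ⟨m, z'⟩) fun h => hne (by simpa using h)
  · exact fun z _ => measurableSet_cell (hℓ m) z

/-- By Cauchy–Schwarz, the standard deviations of the frequencies of the at most `k m ^ m` cells of
cardinality `m` add up to at most `√(k m ^ m * P(|η| = m) / n)`. -/
theorem sum_sqrt_measureReal_cell_le (hℓ : ∀ m, Measurable (ℓ m)) (n m : ℕ) :
    ∑ z : Sym (Fin (k m)) m, √(Q.real (cell (ℓ m) z) / n) ≤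
      √((k m : ℝ) ^ m * Q.real {μ | μ.card = m} / n) := by
  refine Real.le_sqrt_of_sq_le (sq_sum_le_card_mul_sum_sq.trans ?_)
  have h : ∀ z : Sym (Fin (k m)) m,
      √(Q.real (cell (ℓ m) z) / n) ^ 2 = Q.real (cell (ℓ m) z) / n :=
    fun z => Real.sq_sqrt (by positivity)
  simp only [h]
  rw [← Finset.sum_div, sum_measureReal_cell hℓ, mul_div_assoc]
  refine mul_le_mul_of_nonneg_right ?_ (by positivity)
  exact_mod_cast card_sym_fin_le (k m) m

/-- For every choice of labellings `ℓ m` with `k m` labels whose classes have diameter at most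
`δ m`, the expected Wasserstein distance is controlled by a discretization error and by the
fluctuations of the frequencies of the cells. -/
theorem lintegral_wassersteinDist_le [MetricSpace (Option S)] {p : ℝ} (hp : 1 ≤ p) {Δ : ℝ}
    (hΔ : ∀ x y : Option S, dist x y ≤ Δ) (hΔ0 : 0 ≤ Δ) {δ : ℕ → ℝ} (hδ : ∀ m, 0 ≤ δ m)
    (hℓ : ∀ m, Measurable (ℓ m))
    (hdist : ∀ m x y, ℓ m x = ℓ m y → dist (some x) (some y : Option S) ≤ δ m)
    {Ω : Type*} [MeasurableSpace Ω] {P : Measure Ω} [IsProbabilityMeasure P] {n : ℕ} (hn : n ≠ 0)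
    {X : Fin n → Ω → CountingMeasure S} (hX : ∀ i, Measurable (X i)) (hindep : iIndepFun X P)
    (hlaw : ∀ i, P.map (X i) = Q) :
    ∫⁻ ω, wassersteinDist p (empiricalMeasure fun i => X i ω) Q ∂P ≤
      (∑' m : ℕ, ENNReal.ofReal ((m * δ m) ^ p * Q.real {μ | μ.card = m} +
        (m * Δ) ^ p * √((k m : ℝ) ^ m * Q.real {μ | μ.card = m} / n))) ^ (1 / p) := by
  have hp0 : 0 ≤ p := by positivity
  let E : (Σ m, Sym (Fin (k m)) m) → Set (CountingMeasure S) := fun j => cell (ℓ j.1) j.2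
  let a : (Σ m, Sym (Fin (k m)) m) → ℝ≥0∞ := fun j => ENNReal.ofReal ((j.1 * δ j.1) ^ p)
  let b : (Σ m, Sym (Fin (k m)) m) → ℝ≥0∞ := fun j => ENNReal.ofReal ((j.1 * Δ) ^ p)
  have hE : ∀ j, MeasurableSet (E j) := fun j => measurableSet_cell (hℓ j.1) j.2
  let dev : (Σ m, Sym (Fin (k m)) m) → Ω → ℝ≥0∞ := fun j ω =>
    (empiricalMeasure (fun i => X i ω) (E j) - Q (E j)) +
      (Q (E j) - empiricalMeasure (fun i => X i ω) (E j))
  have hdev : ∀ j, Measurable (dev j) := fun j =>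
    ((measurable_empiricalMeasure_apply hX (hE j)).sub_const _).add
      ((measurable_empiricalMeasure_apply hX (hE j)).const_sub _)
  let F : Ω → ℝ≥0∞ := fun ω => ∑' j, a j * Q (E j) + ∑' j, b j * dev j ω
  have hFm : Measurable F :=
    measurable_const.add (Measurable.tsum fun j => (hdev j).const_mul _)
  have hW : ∀ ω, wassersteinDist p (empiricalMeasure fun i => X i ω) Q ≤ F ω ^ (1 / p) := by
    intro ω
    have := isProbabilityMeasure_empiricalMeasure hn fun i => X i ω
    have hcross : ∀ i j, ∀ x ∈ E i, ∀ y ∈ E j, ENNReal.ofReal (D₁ x y ^ p) ≤ b i + b j := by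
      intro i j x hx y hy
      have h := Real.rpow_le_rpow (D₁_nonneg x y) (D₁_le_max_mul hΔ x y) hp0
      rw [hx.1, hy.1] at h
      refine (ENNReal.ofReal_le_ofReal h).trans ?_
      rcases le_total i.1 j.1 with hij | hij
      · rw [max_eq_right hij]
        exact le_add_self
      · rw [max_eq_left hij]
        exact le_self_add
    obtain ⟨γ, hγ, hle⟩ := exists_coupling_lintegral_le hE (pairwise_disjoint_cell ℓ)
      (iUnion_cell ℓ) (empiricalMeasure fun i => X i ω) Q (a := a)
      (c := fun z => ENNReal.ofReal (D₁ z.1 z.2 ^ p))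
      (fun j x hx y hy => ENNReal.ofReal_le_ofReal <|
        Real.rpow_le_rpow (D₁_nonneg _ _) (D₁_le_of_mem_cell (hdist j.1) hx hy) hp0) hcross
    exact ENNReal.rpow_le_rpow ((iInf₂_le γ hγ).trans hle) (by positivity)
  refine (lintegral_mono hW).trans ((lintegral_rpow_inv_le hp hFm.aemeasurable).trans
    (ENNReal.rpow_le_rpow ?_ (by positivity)))
  calc ∫⁻ ω, F ω ∂P
      = ∑' j, a j * Q (E j) + ∑' j, b j * ∫⁻ ω, dev j ω ∂P := by
        rw [lintegral_add_left measurable_const, lintegral_const, measure_univ, mul_one,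
          lintegral_tsum fun j => ((hdev j).const_mul _).aemeasurable]
        simp only [lintegral_const_mul _ (hdev _)]
    _ ≤ ∑' j, a j * Q (E j) + ∑' j, b j * ENNReal.ofReal √(Q.real (E j) / n) := by
        gcongr with j
        exact lintegral_empiricalMeasure_sub_le hn hX hindep hlaw (hE j)
    _ = ∑' m : ℕ, ∑ z : Sym (Fin (k m)) m, ENNReal.ofReal ((m * δ m) ^ p * Q.real (cell (ℓ m) z) +
          (m * Δ) ^ p * √(Q.real (cell (ℓ m) z) / n)) := by
        rw [← ENNReal.tsum_add, ENNReal.tsum_sigma']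
        refine tsum_congr fun m => ?_
        rw [tsum_fintype]
        refine Finset.sum_congr rfl fun z _ => ?_
        have := hδ m
        rw [ENNReal.ofReal_add (by positivity) (by positivity), ENNReal.ofReal_mul (by positivity),
          ENNReal.ofReal_mul (by positivity), ofReal_measureReal]
    _ ≤ _ := by
        refine ENNReal.tsum_le_tsum fun m => ?_
        have := hδ m
        rw [← ENNReal.ofReal_sum_of_nonneg fun z _ => by positivity, Finset.sum_add_distrib,
          ← Finset.mul_sum, ← Finset.mul_sum, sum_measureReal_cell hℓ]
        gcongr
        exact sum_sqrt_measureReal_cell_le hℓ n m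

end Wasserstein

/-! ### Labellings from coverings -/

section Covering

variable {S : Type*} [MetricSpace S]

theorem exists_isCover_encard_eq (ε : ℝ≥0) (Y : Set S) :
    ∃ C : Set S, Metric.IsCover ε Y C ∧ C.encard = Metric.externalCoveringNumber ε Y := by
  have : Nonempty {C : Set S // Metric.IsCover ε Y C} := ⟨⟨Y, Metric.IsCover.refl ε Y⟩⟩
  obtain ⟨C, hC⟩ := ciInf_mem fun C : {C : Set S // Metric.IsCover ε Y C} => C.1.encard
  refine ⟨C.1, C.2, hC.trans ?_⟩
  rw [Metric.externalCoveringNumber, iInf_subtype']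

/-- Each point is labelled by the first ball of a minimal cover that contains it. -/
theorem exists_measurable_label [MeasurableSpace S] [BorelSpace S] {ε : ℝ} (hε : 0 ≤ ε) {k : ℕ}
    (hk : ballCoveringNumber ε (Set.univ : Set S) = k) :
    ∃ ℓ : S → Fin k, Measurable ℓ ∧ ∀ x y, ℓ x = ℓ y → dist x y ≤ ε := by
  classical
  obtain ⟨C, hC, hcard⟩ := exists_isCover_encard_eq (ε / 2).toNNReal (Set.univ : Set S)
  have hcard' : C.encard = k := hcard.trans hk
  have hfin : C.Finite := Set.finite_of_encard_eq_coe hcard'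
  have := hfin.to_subtype
  have hn : Nat.card C = k := by
    rw [Nat.card_coe_set_eq, Set.ncard, hcard', ENat.toNat_natCast]
  let e : C ≃ Fin k := Finite.equivFinOfCardEq hn
  let p : S → ℕ → Prop := fun x i => ∃ h : i < k, dist x (e.symm ⟨i, h⟩ : S) ≤ ε / 2
  have hp : ∀ x, ∃ i, p x i := by
    intro x
    obtain ⟨c, hc, hxc⟩ := hC (Set.mem_univ x)
    refine ⟨e ⟨c, hc⟩, (e ⟨c, hc⟩).2, ?_⟩
    have hxc' : edist x c ≤ ((ε / 2).toNNReal : ℝ≥0∞) := hxc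
    rw [edist_dist, ← ENNReal.ofReal.eq_1, ENNReal.ofReal_le_ofReal_iff (by positivity)] at hxc'
    simpa using hxc'
  have hmeas : Measurable fun x => Nat.find (hp x) := by
    refine measurable_find hp fun i => ?_
    by_cases hi : i < k
    · have : {x | p x i} = Metric.closedBall (e.symm ⟨i, hi⟩ : S) (ε / 2) := by
        ext x
        simp [p, hi]
      rw [this]
      exact Metric.isClosed_closedBall.measurableSet
    · have : {x | p x i} = ∅ := by
        ext x
        simp [p, hi]
      rw [this]
      exact MeasurableSet.empty
  refine ⟨fun x => ⟨Nat.find (hp x), (Nat.find_spec (hp x)).1⟩, ?_, ?_⟩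
  · refine measurable_to_countable' fun i => ?_
    have : (fun x => (⟨Nat.find (hp x), (Nat.find_spec (hp x)).1⟩ : Fin k)) ⁻¹' {i} =
        (fun x => Nat.find (hp x)) ⁻¹' {(i : ℕ)} := by
      ext x
      simp [Fin.ext_iff]
    rw [this]
    exact hmeas (measurableSet_singleton _)
  · intro x y hxy
    have hxy' : Nat.find (hp x) = Nat.find (hp y) := congrArg Fin.val hxy
    obtain ⟨h1, h2⟩ := Nat.find_spec (hp x)
    obtain ⟨h3, h4⟩ := Nat.find_spec (hp y)
    simp only [← hxy'] at h4
    have := dist_triangle_right x y (e.symm ⟨Nat.find (hp x), h1⟩ : S)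
    linarith

/-- If `S` has Minkowski dimension less than `d`, then, for small `ε`, at most `ε ^ (-d)` labels
suffice at scale `ε`. -/
theorem exists_label_of_minkowskiDim_lt [MeasurableSpace S] [BorelSpace S] {d : ℝ}
    (hd : minkowskiDim (Set.univ : Set S) < (d : EReal)) :
    ∃ ε₀ : ℝ, 0 < ε₀ ∧ ∀ ε, 0 < ε → ε < ε₀ → ∃ (k : ℕ) (ℓ : S → Fin k),
      (k : ℝ) ≤ ε ^ (-d) ∧ Measurable ℓ ∧ ∀ x y, ℓ x = ℓ y → dist x y ≤ ε := by
  have h := eventually_lt_of_limsup_lt hd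
  rw [eventually_nhdsWithin_iff, Metric.eventually_nhds_iff] at h
  obtain ⟨r, hr, hr'⟩ := h
  refine ⟨min r (1 / 2), by positivity, fun ε hε hlt => ?_⟩
  have hεr : ε < r := hlt.trans_le (min_le_left _ _)
  have hε1 : ε < 1 := (hlt.trans_le (min_le_right _ _)).trans (by norm_num)
  have hlog : 0 < -Real.log ε := by
    have := Real.log_neg hε hε1
    linarith
  have h1 := @hr' ε (by rwa [Real.dist_eq, sub_zero, abs_of_pos hε]) hε
  rw [EReal.div_lt_iff (by exact_mod_cast hlog) (EReal.coe_ne_top _), ← EReal.coe_mul] at h1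
  have h2 : d * -Real.log ε = Real.log (ε ^ (-d)) := by
    rw [Real.log_rpow hε]
    ring
  rw [h2, ← ENNReal.log_ofReal_of_pos (by positivity), ENNReal.log_lt_log_iff] at h1
  have htop : ballCoveringNumber ε (Set.univ : Set S) ≠ ⊤ := by
    intro h
    rw [h] at h1
    simp at h1
  obtain ⟨k, hk⟩ := ENat.ne_top_iff_exists.1 htop
  obtain ⟨ℓ, hℓ, hdist⟩ := exists_measurable_label hε.le hk.symm
  refine ⟨k, ℓ, ?_, hℓ, hdist⟩
  rw [← hk] at h1
  have h3 : ((k : ℕ) : ℝ≥0∞) < ENNReal.ofReal (ε ^ (-d)) := by simpa using h1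
  rw [← ENNReal.ofReal_natCast, ENNReal.ofReal_lt_ofReal_iff (by positivity)] at h3
  exact h3.le

/-- Adding one point to a compact space gives a bounded space. -/
theorem exists_dist_option_le [CompactSpace S] [MetricSpace (Option S)]
    (hiso : Isometry (some : S → Option S)) :
    ∃ Δ : ℝ, 0 ≤ Δ ∧ ∀ x y : Option S, dist x y ≤ Δ := by
  have hb : Bornology.IsBounded (Set.univ : Set (Option S)) := by
    have h : Bornology.IsBounded (insert none (Set.range (some : S → Option S))) :=
      (isCompact_range hiso.continuous).isBounded.insert none
    refine h.subset fun x _ => ?_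
    cases x <;> simp
  obtain ⟨Δ, hΔ⟩ := Metric.isBounded_iff.1 hb
  exact ⟨Δ, dist_nonneg.trans (hΔ (Set.mem_univ none) (Set.mem_univ none)),
    fun x y => hΔ (Set.mem_univ x) (Set.mem_univ y)⟩

end Covering

/-! ### Optimizing the scale in each cardinality -/

section Optimization

/-- With the scale `ε = exp u`, `u = (λ m - log n) / (2 p + d m)`, the discretization error and the
fluctuations in cardinality `m` are both of order `ε ^ p * exp (-λ m)`, and by the inequality of
arithmetic and geometric means this is at most a constant times `exp (-2 √(p λ / d) √(log n))`,
whatever `m` is. Here `n = exp L`. -/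
theorem cell_error_le_of_scale {p lam d K Δ L q k u m : ℝ} (hp : 1 ≤ p) (hlam : 0 < lam)
    (hd : 0 < d) (hK : 0 < K) (hΔ : 0 ≤ Δ) (hL : 0 ≤ L) (hm : 0 ≤ m) (hk0 : 0 ≤ k)
    (hu : u * (2 * p + d * m) = lam * m - L) (hq : q ≤ K * Real.exp (-lam * m))
    (hk : k ≤ Real.exp u ^ (-d)) :
    (m * Real.exp u) ^ p * q + (m * Δ) ^ p * √(k ^ m * q / Real.exp L) ≤
      (K + Δ ^ p * √K) * Real.exp (3 * (p * lam / d)) * m ^ p *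
        Real.exp (-(2 * √(p * lam / d) * √L)) := by
  have hp0 : 0 < p := by linarith
  have hkm : k ^ m ≤ Real.exp (-(d * m * u)) := by
    refine (Real.rpow_le_rpow hk0 hk hm).trans_eq ?_
    rw [← Real.exp_mul, ← Real.exp_mul]
    congr 1
    ring
  have hsq : √(k ^ m * q / Real.exp L) ≤ √K * Real.exp (p * u - lam * m) := by
    refine Real.sqrt_le_iff.2 ⟨by positivity, ?_⟩
    rw [mul_pow, Real.sq_sqrt hK.le, ← Real.exp_nat_mul, div_le_iff₀ (Real.exp_pos _)]
    have hkm0 : 0 ≤ k ^ m := by positivity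
    calc k ^ m * q ≤ Real.exp (-(d * m * u)) * (K * Real.exp (-lam * m)) :=
          (mul_le_mul_of_nonneg_left hq hkm0).trans
            (mul_le_mul_of_nonneg_right hkm (by positivity))
      _ = K * Real.exp (-(d * m * u) + -lam * m) := by rw [Real.exp_add]; ring
      _ = K * Real.exp ((2 : ℕ) * (p * u - lam * m)) * Real.exp L := by
          rw [mul_assoc K, ← Real.exp_add]
          congr 2
          push_cast
          linarith
  have hexp : p * u - lam * m ≤ 3 * (p * lam / d) + -(2 * √(p * lam / d) * √L) := by
    set D := 2 * p + d * m with hD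
    have hD0 : 0 < D := by positivity
    have hu' : u = lam * m / D - L / D := by
      rw [← sub_div, eq_div_iff hD0.ne', hu]
    have h1 : p * (lam * m / D) ≤ p * lam / d := by
      rw [mul_div_assoc']
      rw [div_le_div_iff₀ hD0 hd]
      have : 0 ≤ p * lam * (2 * p) := by positivity
      rw [hD]
      nlinarith
    have h2 : lam * m = lam / d * D - 2 * (p * lam / d) := by
      rw [hD]
      field_simp
      ring
    have h3 : 2 * √(p * lam / d) * √L ≤ p * (L / D) + lam / d * D := by
      have h := two_mul_le_add_sq √(p * (L / D)) √(lam / d * D)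
      rw [Real.sq_sqrt (by positivity), Real.sq_sqrt (by positivity), mul_assoc,
        ← Real.sqrt_mul (by positivity)] at h
      rw [mul_assoc, ← Real.sqrt_mul (by positivity)]
      have h4 : p * (L / D) * (lam / d * D) = p * lam / d * L := by field_simp
      rwa [h4] at h
    rw [hu', mul_sub]
    linarith
  calc (m * Real.exp u) ^ p * q + (m * Δ) ^ p * √(k ^ m * q / Real.exp L)
      ≤ (m * Real.exp u) ^ p * (K * Real.exp (-lam * m)) +
          (m * Δ) ^ p * (√K * Real.exp (p * u - lam * m)) := by gcongr
    _ = (K + Δ ^ p * √K) * m ^ p * Real.exp (p * u - lam * m) := by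
        rw [Real.mul_rpow hm (Real.exp_pos u).le, Real.mul_rpow hm hΔ, ← Real.exp_mul,
          sub_eq_add_neg, Real.exp_add, mul_comm u p, neg_mul]
        ring
    _ ≤ (K + Δ ^ p * √K) * m ^ p *
          Real.exp (3 * (p * lam / d) + -(2 * √(p * lam / d) * √L)) := by gcongr
    _ = _ := by
        rw [Real.exp_add]
        ring

/-- Large cardinalities need no subdivision: a single cell of diameter `Δ` is good enough. -/
theorem cell_error_le_of_single {p lam K Δ q m n : ℝ} (hlam : 0 < lam) (hK : 0 < K) (hΔ : 0 ≤ Δ)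
    (hm : 0 ≤ m) (hn : 1 ≤ n) (hq : q ≤ K * Real.exp (-lam * m)) :
    (m * Δ) ^ p * q + (m * Δ) ^ p * √(q / n) ≤
      Δ ^ p * (K + √K) * m ^ p * Real.exp (-(lam * m / 2)) := by
  have h1 : Real.exp (-lam * m) ≤ Real.exp (-(lam * m / 2)) := by
    have := mul_nonneg hlam.le hm
    exact Real.exp_le_exp.2 (by linarith)
  have h2 : √(q / n) ≤ √K * Real.exp (-(lam * m / 2)) := by
    refine Real.sqrt_le_iff.2 ⟨by positivity, ?_⟩
    rw [mul_pow, Real.sq_sqrt hK.le, ← Real.exp_nat_mul]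
    calc q / n ≤ K * Real.exp (-lam * m) / n := by gcongr
      _ ≤ K * Real.exp (-lam * m) := div_le_self (by positivity) hn
      _ = _ := by
        congr 2
        push_cast
        ring
  calc (m * Δ) ^ p * q + (m * Δ) ^ p * √(q / n)
      ≤ (m * Δ) ^ p * (K * Real.exp (-(lam * m / 2))) +
          (m * Δ) ^ p * (√K * Real.exp (-(lam * m / 2))) := by
        gcongr
        exact hq.trans (by gcongr)
    _ = _ := by
        rw [Real.mul_rpow hm hΔ]
        ring

theorem summable_rpow_mul_exp_neg {p θ : ℝ} (hθ : 0 < θ) :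
    Summable fun m : ℕ => (m : ℝ) ^ p * Real.exp (-θ * m) := by
  refine (Real.summable_pow_mul_exp_neg_nat_mul (⌈p⌉₊) hθ).of_norm_bounded_eventually_nat ?_
  filter_upwards [eventually_ge_atTop 1] with m hm
  rw [Real.norm_of_nonneg (by positivity), ← Real.rpow_natCast]
  gcongr
  · exact_mod_cast hm
  · exact Nat.le_ceil p

/-- For cardinalities `m ≤ A √(log n)`, the optimal scale tends to `0` uniformly in `m`. -/
theorem eventually_scale_lt {p lam d A ε₀ : ℝ} (hp : 0 < p) (hlam : 0 < lam) (hd : 0 < d)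
    (hε : 0 < ε₀) :
    ∀ᶠ s : ℝ in atTop, ∀ m : ℝ, 0 ≤ m → m ≤ A * s →
      Real.exp ((lam * m - s ^ 2) / (2 * p + d * m)) < ε₀ := by
  set c := |Real.log ε₀| with hc
  have hc0 : 0 ≤ c := abs_nonneg _
  filter_upwards [eventually_gt_atTop ((lam + c * d) * A + c * (2 * p) + 1),
    eventually_ge_atTop 1] with s hs hs1 m hm hmA
  rw [← Real.lt_log_iff_exp_lt hε, div_lt_iff₀ (by positivity)]
  have h1 : -c ≤ Real.log ε₀ := neg_abs_le _
  have hD : 0 ≤ 2 * p + d * m := by positivity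
  have h2 := mul_le_mul_of_nonneg_right h1 hD
  have h3 : (lam + c * d) * m ≤ (lam + c * d) * (A * s) :=
    mul_le_mul_of_nonneg_left hmA (by positivity)
  have h4 : c * (2 * p) ≤ c * (2 * p) * s := le_mul_of_one_le_right (by positivity) hs1
  have h5 := mul_lt_mul_of_pos_right hs (zero_lt_one.trans_le hs1)
  nlinarith

end Optimization

/-! ### The rate of convergence -/

section Rate

open CountingMeasure

/-- The rate with constant one. The dimension `d'`, strictly between the Minkowski dimension and
`d''`, leaves a margin in the exponent that absorbs all constants and the sum over the
cardinalities. -/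
theorem eventually_lintegral_wassersteinDist_le {S : Type u} [MetricSpace S] [CompactSpace S]
    [MeasurableSpace S] [BorelSpace S] [MetricSpace (Option S)]
    (hiso : Isometry (some : S → Option S)) {p lam K d' d'' : ℝ} (hp : 1 ≤ p) (hlam : 0 < lam)
    (hK : 0 < K) (hd' : 0 < d') (hdd : d' < d'')
    (hdim : minkowskiDim (Set.univ : Set S) < (d' : EReal)) {Q : Measure (CountingMeasure S)}
    [IsProbabilityMeasure Q]
    (hQ : ∀ m : ℕ, Q.real {μ | μ.card = m} ≤ K * Real.exp (-lam * m)) :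
    ∀ᶠ n : ℕ in atTop, ∀ (Ω : Type w) [MeasurableSpace Ω] (P : Measure Ω)
      [IsProbabilityMeasure P] (X : Fin n → Ω → CountingMeasure S), (∀ i, Measurable (X i)) →
      iIndepFun X P → (∀ i, P.map (X i) = Q) →
      ∫⁻ ω, wassersteinDist p (empiricalMeasure fun i => X i ω) Q ∂P ≤
        ENNReal.ofReal (Real.exp (-2 * √(lam / (p * d'')) * √(Real.log n))) := by
  have hp0 : 0 < p := by linarith
  have hd'' : 0 < d'' := hd'.trans hdd
  obtain ⟨Δ, hΔ0, hΔ⟩ := exists_dist_option_le hiso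
  obtain ⟨ε₀, hε₀, hlabel⟩ := exists_label_of_minkowskiDim_lt hdim
  set a := 2 * √(p * lam / d') with ha
  set b := 2 * √(p * lam / d'') with hb
  have hab : b < a := by
    rw [ha, hb]
    gcongr
  have ha0 : 0 < a := by positivity
  set A := 4 * a / lam with hA
  have hA0 : 0 < A := by positivity
  set θ := min (lam / 4) ((a - b) / (2 * A)) with hθ
  have hθ0 : 0 < θ := lt_min (by positivity) (div_pos (by linarith) (by positivity))
  have hθ1 : θ ≤ lam / 4 := min_le_left _ _
  have hθ2 : θ * A ≤ (a - b) / 2 := by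
    refine (mul_le_mul_of_nonneg_right (min_le_right _ _) hA0.le).trans_eq ?_
    field_simp
  set C := (K + Δ ^ p * √K) * Real.exp (3 * (p * lam / d')) + Δ ^ p * (K + √K) with hC
  have hC0 : 0 ≤ C := by positivity
  set G := ∑' m : ℕ, (m : ℝ) ^ p * Real.exp (-θ * m) with hG
  have hG0 : 0 ≤ G := tsum_nonneg fun m => by positivity
  have hs : Tendsto (fun n : ℕ => √(Real.log n)) atTop atTop :=
    Real.tendsto_sqrt_atTop.comp (Real.tendsto_log_atTop.comp tendsto_natCast_atTop_atTop)
  -- The factor `C * G` is absorbed by the margin between `(a + b) / 2` and `b`.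
  have hconst : ∀ᶠ s : ℝ in atTop, C * G ≤ Real.exp ((a - b) / 2 * s) :=
    (Real.tendsto_exp_atTop.comp (tendsto_id.const_mul_atTop
      (by linarith : 0 < (a - b) / 2))).eventually_ge_atTop _
  filter_upwards [hs.eventually (eventually_scale_lt (A := A) hp0 hlam hd' hε₀),
    hs.eventually hconst, eventually_ge_atTop 1] with n hscale hCG hn Ω _ P _ X hX hindep hlaw
  have hnR : (1 : ℝ) ≤ n := by exact_mod_cast hn
  have hlog : 0 ≤ Real.log n := Real.log_nonneg hnR
  set s := √(Real.log n) with hsdef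
  have hs0 : 0 ≤ s := Real.sqrt_nonneg _
  have hs2 : s ^ 2 = Real.log n := Real.sq_sqrt hlog
  set Y := Real.exp (-((a + b) / 2 * s)) with hY
  have hterm : ∀ m : ℕ, ∃ (k : ℕ) (ℓ : S → Fin k) (δ : ℝ), 0 ≤ δ ∧ Measurable ℓ ∧
      (∀ x y, ℓ x = ℓ y → dist (some x) (some y : Option S) ≤ δ) ∧
      (m * δ) ^ p * Q.real {μ | μ.card = m} +
        (m * Δ) ^ p * √((k : ℝ) ^ m * Q.real {μ | μ.card = m} / n) ≤
          C * Y * ((m : ℝ) ^ p * Real.exp (-θ * m)) := by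
    intro m
    have hm0 : (0 : ℝ) ≤ m := Nat.cast_nonneg m
    -- `A` and `θ` are such that the bound in either range leaves the factors `exp (-θ m)`, which
    -- makes the sum over `m` converge, and `Y`.
    rcases le_or_gt (m : ℝ) (A * s) with hmA | hmA
    · set u := (lam * m - s ^ 2) / (2 * p + d' * m) with hu
      obtain ⟨k, ℓ, hk, hℓ, hdist⟩ := hlabel _ (Real.exp_pos u) (hscale m hm0 hmA)
      refine ⟨k, ℓ, Real.exp u, (Real.exp_pos u).le, hℓ,
        fun x y hxy => (hiso.dist_eq x y).trans_le (hdist x y hxy), ?_⟩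
      have h := cell_error_le_of_scale (L := Real.log n) (u := u) hp hlam hd' hK hΔ0 hlog hm0
        (Nat.cast_nonneg k) (by rw [hu, hs2]; exact div_mul_cancel₀ _ (by positivity)) (hQ m) hk
      rw [Real.exp_log (by positivity), Real.rpow_natCast] at h
      refine h.trans ?_
      have hE : Real.exp (-(2 * √(p * lam / d') * √(Real.log n))) ≤
          Y * Real.exp (-θ * m) := by
        rw [hY, ← Real.exp_add, Real.exp_le_exp, ← hsdef, ← ha]
        have h1 := mul_le_mul_of_nonneg_left hmA hθ0.le
        have h2 := mul_le_mul_of_nonneg_right hθ2 hs0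
        linarith
      calc _ ≤ C * (m : ℝ) ^ p * (Y * Real.exp (-θ * m)) := by
            gcongr
            exact le_add_of_nonneg_right (by positivity)
        _ = _ := by ring
    · refine ⟨1, fun _ => 0, Δ, hΔ0, measurable_const, fun x y _ => hΔ _ _, ?_⟩
      have h := cell_error_le_of_single (p := p) hlam hK hΔ0 hm0 hnR (hQ m)
      rw [Nat.cast_one, one_pow, one_mul]
      refine h.trans ?_
      have hE : Real.exp (-(lam * m / 2)) ≤ Y * Real.exp (-θ * m) := by
        rw [hY, ← Real.exp_add, Real.exp_le_exp]
        have h1 : lam / 4 * (A * s) = a * s := by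
          rw [hA]
          field_simp
        have h2 := mul_le_mul_of_nonneg_left hmA.le (by positivity : 0 ≤ lam / 4)
        have h3 := mul_le_mul_of_nonneg_right hθ1 hm0
        have h4 := mul_le_mul_of_nonneg_right hab.le hs0
        linarith
      calc _ ≤ C * (m : ℝ) ^ p * (Y * Real.exp (-θ * m)) := by
            gcongr
            exact le_add_of_nonneg_left (by positivity)
        _ = _ := by ring
  choose k ℓ δ hδ hℓ hdist hbound using hterm
  refine (lintegral_wassersteinDist_le hp hΔ hΔ0 hδ hℓ hdist (by omega) hX hindep hlaw).trans ?_
  have hsum : ∑' m : ℕ, ENNReal.ofReal ((m * δ m) ^ p * Q.real {μ | μ.card = m} +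
      (m * Δ) ^ p * √((k m : ℝ) ^ m * Q.real {μ | μ.card = m} / n)) ≤
        ENNReal.ofReal (Real.exp (-(b * s))) := by
    refine (ENNReal.tsum_le_tsum fun m => ENNReal.ofReal_le_ofReal (hbound m)).trans ?_
    rw [← ENNReal.ofReal_tsum_of_nonneg (fun m => by positivity)
      ((summable_rpow_mul_exp_neg hθ0).mul_left _), tsum_mul_left]
    refine ENNReal.ofReal_le_ofReal ?_
    calc C * Y * G = C * G * Y := by ring
      _ ≤ Real.exp ((a - b) / 2 * s) * Y := by gcongr
      _ = _ := by
        rw [hY, ← Real.exp_add]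
        congr 1
        ring
  refine (ENNReal.rpow_le_rpow hsum (by positivity)).trans_eq ?_
  rw [ENNReal.ofReal_rpow_of_pos (Real.exp_pos _), ← Real.exp_mul]
  congr 2
  have h1 : √(p * lam / d'') = p * √(lam / (p * d'')) := by
    rw [show p * lam / d'' = p ^ 2 * (lam / (p * d'')) by field_simp,
      Real.sqrt_mul (by positivity), Real.sqrt_sq hp0.le]
  rw [hb, h1]
  field_simp

end Rate


theorem theorem2 (p κ lam K₁ α diamS dimS : ℝ) (hp : 1 ≤ p) (hκ : 0 < κ) (hlam : 0 < lam)
    (hK₁ : 0 < K₁) (hdim : 0 < dimS) :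
    -- the constant depends only on the real parameters listed above
    ∃ C : ℝ, 0 < C ∧
      ∀ (S : Type u) [MetricSpace S] [CompactSpace S] [MeasurableSpace S] [BorelSpace S]
        -- the metric space obtained from `S` by adding a point `none` at distance `α` from `S`
        [MetricSpace (Option S)],
        Isometry (some : S → Option S) →
        (⨅ s : S, dist (some s) (none : Option S)) = α →
        Metric.diam (Set.univ : Set S) = diamS →
        minkowskiDim (Set.univ : Set S) = (dimS : EReal) →
        -- the point process `η`
        ∀ (Ω₀ : Type v) [MeasurableSpace Ω₀] (P₀ : Measure Ω₀) [IsProbabilityMeasure P₀]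
          (η : Ω₀ → CountingMeasure S), Measurable η →
          (∀ m : ℕ, P₀.real {ω | (η ω).card = m} ≤ K₁ * Real.exp (-lam * m)) →
          ∀ᶠ n : ℕ in atTop,
            -- independent copies `η' 0, …, η' (n - 1)` of `η`, on any probability space
            ∀ (Ω : Type w) [MeasurableSpace Ω] (P : Measure Ω) [IsProbabilityMeasure P]
              (η' : Fin n → Ω → CountingMeasure S), (∀ i, Measurable (η' i)) →
              iIndepFun η' P → (∀ i, IdentDistrib (η' i) η P P₀) →
              ∫⁻ ω, wassersteinDist p (empiricalMeasure fun i => η' i ω) (P₀.map η) ∂P ≤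
                  ENNReal.ofReal (C * Real.exp ((1 + 1 / (2 * p)) * Real.log (Real.log n)) *
                    Real.exp (-2 * √(lam / (p * (dimS + κ))) * √(Real.log n))) ∧
              ∫⁻ ω, wassersteinDist p (empiricalMeasure fun i => η' i ω) (P₀.map η) ∂P ≤
                  ENNReal.ofReal (C *
                    Real.exp (-2 * √(lam / (p * (dimS + 2 * κ))) * √(Real.log n))) := by
  -- The threshold for `n` may depend on all the data, so the margin `κ` leaves room for `C = 1`.
  refine ⟨1, one_pos, ?_⟩
  intro S _ _ _ _ _ hiso _ _ hS Ω₀ _ P₀ _ η hη hcard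
  have hQ : IsProbabilityMeasure (P₀.map η) := Measure.isProbabilityMeasure_map hη.aemeasurable
  have hrate := eventually_lintegral_wassersteinDist_le (K := K₁) (d' := dimS + κ / 2)
    (d'' := dimS + κ) hiso hp hlam hK₁ (by linarith) (by linarith)
    (by rw [hS]; exact_mod_cast (by linarith : dimS < dimS + κ / 2)) (Q := P₀.map η) fun m => by
      rw [map_measureReal_apply hη (measurableSet_card_eq m)]
      exact hcard m
  have hloglog : ∀ᶠ n : ℕ in atTop, 0 ≤ Real.log (Real.log n) :=
    (Real.tendsto_log_atTop.comp (Real.tendsto_log_atTop.comp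
      tendsto_natCast_atTop_atTop)).eventually_ge_atTop 0
  -- For `n` large the factor `exp ((1 + 1 / (2 p)) log log n)` is at least one.
  filter_upwards [hrate, hloglog] with n hn hn' Ω _ P _ η' hη' hindep hident
  have hmain := hn Ω P η' hη' hindep fun i => (hident i).map_eq
  refine ⟨hmain.trans (ENNReal.ofReal_le_ofReal ?_), hmain.trans (ENNReal.ofReal_le_ofReal ?_)⟩
  · rw [one_mul]
    exact le_mul_of_one_le_left (Real.exp_pos _).le (Real.one_le_exp (by positivity))
  · rw [one_mul, Real.exp_le_exp]
    have h : √(lam / (p * (dimS + 2 * κ))) ≤ √(lam / (p * (dimS + κ))) := by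
      gcongr
      linarith
    have := mul_le_mul_of_nonneg_right h (Real.sqrt_nonneg (Real.log n))
    linarith
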